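/- \textbf{The model.} Let $n\ge 2$, $p\in[0,1]$ and $\epsilon_b\in\mathbb{R}$. Under the HLV (Hand--Lee--Voroninski) model with parameters $n,p,\epsilon_b$, the camera locations $\boldsymbol t_1^*,\dots,\boldsymbol t_n^*\in\mathbb{R}^3$ are i.i.d. $N(\boldsymbol 0,\boldsymbol I)$, and independently of them $E$ is the edge set of an Erdős--Rényi graph $G(n,p)$ on $[n]$ (each edge is listed once, as $ij$ with $i<j$). The edges are partitioned as $E=E_g\cup E_b$ into good and bad edges, and each edge $ij\in E$ is assigned a direction $\boldsymbol\gamma_{ij}\in S^2$: for $ij\in E_g$, $\boldsymbol\gamma_{ij}=(\boldsymbol t_i^*-\boldsymbol t_j^*)/\|\boldsymbol t_i^*-\boldsymbol t_j^*\|$, while $E_b$ and the unit vectors $\boldsymbol\gamma_{ij}$, $ij\in E_b$, are arbitrary (they may depend on the locations and on $E$), subject to $\frac1n(\text{maximal degree of }E_b)\le\epsilon_b$. \textbf{The scale.} For $ij\in E$ let $$f_{ij}(\boldsymbol t_i,\boldsymbol t_j)=\begin{cases}\|P_{\boldsymbol\gamma_{ij}^\perp}(\boldsymbol t_i-\boldsymbol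 t_j)\|,&\langle\boldsymbol\gamma_{ij},\boldsymbol t_i-\boldsymbol t_j\rangle>1,\\ \|\boldsymbol t_i-\boldsymbol t_j-\boldsymbol\gamma_{ij}\|,&\langle\boldsymbol\gamma_{ij},\boldsymbol t_i-\boldsymbol t_j\rangle\le1,\end{cases}$$ where $P_{\boldsymbol\gamma_{ij}^\perp}$ is the orthogonal projection onto the orthogonal complement of $\boldsymbol\gamma_{ij}$. A pair $(c^*,\boldsymbol t_s)\in\mathbb{R}\times\mathbb{R}^3$ is an oracle solution if it minimizes $\sum_{ij\in E}f_{ij}(c\boldsymbol t_i^*+\boldsymbol t,\,c\boldsymbol t_j^*+\boldsymbol t)$ over all $(c,\boldsymbol t)\in\mathbb{R}\times\mathbb{R}^3$ with $\sum_{i=1}^n(c\boldsymbol t_i^*+\boldsymbol t)=\boldsymbol 0$. Put $E_{gl}=\{ij\in E_g:\|\boldsymbol t_i^*-\boldsymbol t_j^*\|>1/c^*\}$ if $c^*>0$ and $E_{gl}=\emptyset$ if $c^*\le 0$, let $E_{gl}^c=E\setminus E_{gl}$, and let $\epsilon_0=\frac1n(\text{maximal degree of }E_{gl}^c)$. \textbf{Theorem.}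 For all constants $C_0,C_1>0$ there are constants $K,C>0$ and $n_0$, depending only on $C_0$ and $C_1$, such that for all $n\ge n_0$ and all $p,\epsilon_b$ with $$C_0\Big(\frac{\log n}{n}\Big)^{1/3}\le p\le 1\qquad\text{and}\qquad \epsilon_b\le C_1\,\frac{p^{7/3}}{\log^{9/2}n},$$ if the data are generated by the HLV model with parameters $n,p,\epsilon_b$, then with probability at least $1-C n^{-5}$ every oracle solution $(c^*,\boldsymbol t_s)$ satisfies $$\epsilon_0\le K\,\frac{p^2}{\log^3 n}.$$ -/

import Mathlib

namespace HLV

open MeasureTheory ProbabilityTheory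

/-- Camera locations and directions live in Euclidean three-space. -/
abbrev E3 : Type := EuclideanSpace ℝ (Fin 3)

/-- `(maximal degree of G) / n` for a graph on `n` vertices. -/
noncomputable def normMaxDegree {n : ℕ} (G : SimpleGraph (Fin n)) : ℝ := by
  classical exact (G.maxDegree : ℝ) / n

/-- The true unit direction from `y` to `x`. -/
noncomputable def direction (x y : E3) : E3 := ‖x - y‖⁻¹ • (x - y)

/-- A possibly corrupted assignment of pairwise directions to the edges of the graph `E` on the
locations `t`, with set of bad edges `Eb`. Each edge is listed once, as `ij` with `i < j`, and only
the values `γ i j` with `i < j` and `ij` an edge are meaningful. Good edges (the edges of `E` not in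
`Eb`) carry the true direction, bad edges carry arbitrary unit vectors. -/
structure IsCorruptedData {n : ℕ} (t : Fin n → E3) (E Eb : SimpleGraph (Fin n))
    (γ : Fin n → Fin n → E3) : Prop where
  bad_le : Eb ≤ E
  good : ∀ i j, i < j → (E \ Eb).Adj i j → γ i j = direction (t i) (t j)
  bad : ∀ i j, i < j → Eb.Adj i j → ‖γ i j‖ = 1

/-- The model with parameters `n`, `p`, `εb`: the locations `t` are i.i.d. standard Gaussian vectors
in three-space, the graph `E` is an Erdős–Rényi graph independent of the locations, and the bad
edges and their directions are chosen arbitrarily (possibly depending on `t` and `E`, and without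
any measurability requirement), subject to the normalized maximal degree of the bad edges being at
most `εb`. -/
structure IsHLVModel {n : ℕ} (p : unitInterval) (εb : ℝ) {Ω : Type*} [MeasurableSpace Ω]
    (P : Measure Ω) (t : Ω → Fin n → E3) (E Eb : Ω → SimpleGraph (Fin n))
    (γ : Ω → Fin n → Fin n → E3) : Prop where
  law : HasLaw (fun ω => (t ω, E ω))
    ((Measure.pi fun _ : Fin n => stdGaussian E3).prod (SimpleGraph.binomialRandom (Fin n) p)) P
  data : ∀ᵐ ω ∂P, IsCorruptedData (t ω) (E ω) (Eb ω) (γ ω)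
  level : ∀ᵐ ω ∂P, normMaxDegree (Eb ω) ≤ εb

/-- The contribution of an edge with assigned direction `g` and endpoints `x`, `y` to the objective
of least unsquared deviations, i.e. `‖x - y - a • g‖` minimized over `a ≥ 1` (for unit `g`). -/
noncomputable def edgeLoss (g x y : E3) : ℝ := by
  classical exact
    if 1 < inner ℝ g (x - y) then ‖(Submodule.span ℝ {g})ᗮ.starProjection (x - y)‖
    else ‖x - y - g‖

/-- The objective of least unsquared deviations: the sum of the losses of the edges of `E`. -/
noncomputable def objective {n : ℕ} (E : SimpleGraph (Fin n)) (γ : Fin n → Fin n → E3)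
    (x : Fin n → E3) : ℝ := by
  classical exact
    ∑ i, ∑ j, if i < j ∧ E.Adj i j then edgeLoss (γ i j) (x i) (x j) else 0

/-- `(c, s)` solves the oracle problem: among all centered configurations of the form
`c' • t i + s'`, the configuration `c • t i + s` minimizes the objective. -/
def IsOracleSolution {n : ℕ} (t : Fin n → E3) (E : SimpleGraph (Fin n))
    (γ : Fin n → Fin n → E3) (c : ℝ) (s : E3) : Prop :=
  ∑ i, (c • t i + s) = 0 ∧
    ∀ (c' : ℝ) (s' : E3), ∑ i, (c' • t i + s') = 0 →
      objective E γ (fun i => c • t i + s) ≤ objective E γ (fun i => c' • t i + s')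

/-- The good-long edges at scale `c`: good edges of length greater than `1 / c`. If `c ≤ 0`, then
`1 / c` is not a length threshold and no edge counts as long. -/
def goodLong {n : ℕ} (t : Fin n → E3) (E Eb : SimpleGraph (Fin n)) (c : ℝ) :
    SimpleGraph (Fin n) where
  Adj i j := (E \ Eb).Adj i j ∧ 0 < c ∧ 1 / c < ‖t i - t j‖
  symm := ⟨fun i j h => ⟨h.1.symm, h.2.1, by rw [norm_sub_rev]; exact h.2.2⟩⟩
  loopless := ⟨fun i h => (E \ Eb).loopless.irrefl i h.1⟩

/-- The normalized maximal degree of the edges of `E` that are not good-long at scale `c`. -/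
noncomputable def epsZero {n : ℕ} (t : Fin n → E3) (E Eb : SimpleGraph (Fin n)) (c : ℝ) : ℝ :=
  normMaxDegree (E \ goodLong t E Eb c)

end HLV

/-!
Changing the scale from `c < 1 / r` to `1 / r` decreases the loss of each good edge of length
`ℓ ≤ r` by at least `(1 / r - c) * ℓ`, does not increase the loss of the longer good edges, and
increases the loss of each bad edge of length `ℓ` by at most `(1 / r - c) * ℓ`. Hence an oracle
solution with scale `c < 1 / r` forces the total length of the edges of length at most `r` to be at
most twice that of the bad edges. With high probability this is false: all locations have norm
`O(√log n)`, and a positive proportion of the vertices has `≳ p * r ^ 3 * n` neighbours at distance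
between `r / 2` and `r`, so that it suffices that `√log n * εb ≪ p * r ^ 4`. Thus `1 / r ≤ c`, every
edge that is not good-long is bad or has length at most `r`, and the normalized maximal degree of
the graph of the latter is `O(p * r ^ 3)`. The choice `r = a * p ^ (1 / 3) / log n`, with a large
constant `a`, balances these requirements.
-/

namespace HLV

open MeasureTheory ProbabilityTheory Filter

section Chernoff

open scoped Classical in
/-- The number of indices `i` such that `w i` lies in `B`. -/
noncomputable def hitCount {ι Y : Type*} [Fintype ι] (B : Set Y) (w : ι → Y) : ℕ :=
  (Finset.univ.filter fun i => w i ∈ B).card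

variable {ι Y : Type*} [Fintype ι] {B : Set Y}

theorem hitCount_eq_sum_indicator (w : ι → Y) :
    (hitCount B w : ℝ) = ∑ i, B.indicator (fun _ => (1 : ℝ)) (w i) := by
  classical
  simp [hitCount, Set.indicator_apply, Finset.sum_boole]

variable [MeasurableSpace Y] (ρ : Measure Y) [IsProbabilityMeasure ρ]

theorem measurable_hitCount (hB : MeasurableSet B) :
    Measurable fun w : ι → Y => hitCount B w := by
  classical
  simp only [hitCount, Finset.card_filter]
  exact Finset.measurable_fun_sum _ fun i _ =>
    Measurable.ite (measurable_pi_apply i hB) measurable_const measurable_const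

theorem integrable_exp_mul_hitCount (hB : MeasurableSet B) (l : ℝ) :
    Integrable (fun w : ι → Y => Real.exp (l * hitCount B w)) (Measure.pi fun _ => ρ) := by
  refine Integrable.of_bound (C := Real.exp (|l| * Fintype.card ι))
    ((measurable_from_top.comp (measurable_hitCount hB)).const_mul l).exp.aestronglyMeasurable
    (ae_of_all _ fun w => ?_)
  have hcard : (hitCount B w : ℝ) ≤ Fintype.card ι := by exact_mod_cast Finset.card_le_univ _
  rw [Real.norm_of_nonneg (Real.exp_pos _).le]
  gcongr
  exact le_abs_self l

theorem mgf_indicator_one (hB : MeasurableSet B) (l : ℝ) :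
    mgf (B.indicator fun _ => 1) ρ l = 1 + (Real.exp l - 1) * ρ.real B := by
  have h : ∀ y, Real.exp (l * B.indicator (fun _ => 1) y) =
      1 + B.indicator (fun _ => Real.exp l - 1) y := by
    intro y
    by_cases hy : y ∈ B <;> simp [hy]
  simp only [mgf, h]
  rw [integral_add (integrable_const _) ((integrable_const _).indicator hB),
    integral_indicator_const _ hB]
  simp [mul_comm]

theorem mgf_hitCount_le (hB : MeasurableSet B) (l : ℝ) :
    mgf (fun w : ι → Y => (hitCount B w : ℝ)) (Measure.pi fun _ => ρ) l ≤
      Real.exp (Fintype.card ι * ((Real.exp l - 1) * ρ.real B)) := by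
  have hind : Measurable (B.indicator fun _ => (1 : ℝ)) := measurable_const.indicator hB
  have hindep := iIndepFun_pi (μ := fun _ : ι => ρ) (fun _ => hind.aemeasurable)
  have hmgf (i : ι) : mgf (fun w : ι → Y => B.indicator (fun _ => 1) (w i))
      (Measure.pi fun _ => ρ) l = 1 + (Real.exp l - 1) * ρ.real B := by
    have hmap := mgf_map (μ := Measure.pi fun _ : ι => ρ) (Y := Function.eval i) (t := l)
      (X := B.indicator fun _ => (1 : ℝ)) (measurable_pi_apply i).aemeasurable (by fun_prop)
    rw [(measurePreserving_eval (fun _ : ι => ρ) i).map_eq, mgf_indicator_one ρ hB] at hmap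
    exact hmap.symm
  calc mgf (fun w : ι → Y => (hitCount B w : ℝ)) (Measure.pi fun _ => ρ) l
      = mgf (∑ i, fun w : ι → Y => B.indicator (fun _ => 1) (w i)) (Measure.pi fun _ => ρ) l := by
        congr 1
        ext w
        simp [hitCount_eq_sum_indicator]
    _ = (1 + (Real.exp l - 1) * ρ.real B) ^ Fintype.card ι := by
        rw [hindep.mgf_sum (fun i => by fun_prop)]
        simp [hmgf]
    _ ≤ Real.exp ((Real.exp l - 1) * ρ.real B) ^ Fintype.card ι := by
        refine pow_le_pow_left₀ (mgf_indicator_one ρ hB l ▸ mgf_nonneg) ?_ _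
        linarith [Real.add_one_le_exp ((Real.exp l - 1) * ρ.real B)]
    _ = Real.exp (Fintype.card ι * ((Real.exp l - 1) * ρ.real B)) := by rw [Real.exp_nat_mul]

theorem measureReal_hitCount_ge_le (hB : MeasurableSet B) {q : ℝ} (hq : ρ.real B ≤ q) (k : ℝ) :
    (Measure.pi fun _ : ι => ρ).real {w | k ≤ hitCount B w} ≤
      Real.exp (2 * q * Fintype.card ι - k) := by
  refine (measure_ge_le_exp_mul_mgf k zero_le_one
    (integrable_exp_mul_hitCount ρ hB 1)).trans ?_
  refine (mul_le_mul_of_nonneg_left (mgf_hitCount_le ρ hB 1) (Real.exp_pos _).le).trans ?_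
  rw [← Real.exp_add, Real.exp_le_exp]
  have hmean : (Real.exp 1 - 1) * ρ.real B ≤ 2 * q := by
    nlinarith [Real.exp_one_lt_d9, measureReal_nonneg (μ := ρ) (s := B)]
  nlinarith [Nat.cast_nonneg (α := ℝ) (Fintype.card ι)]

theorem measureReal_hitCount_le_le (hB : MeasurableSet B) {q : ℝ} (hq : q ≤ ρ.real B) (k : ℝ) :
    (Measure.pi fun _ : ι => ρ).real {w | (hitCount B w : ℝ) ≤ k} ≤
      Real.exp (k - q * Fintype.card ι / 2) := by
  refine (measure_le_le_exp_mul_mgf k (neg_nonpos.2 zero_le_one)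
    (integrable_exp_mul_hitCount ρ hB (-1))).trans ?_
  refine (mul_le_mul_of_nonneg_left (mgf_hitCount_le ρ hB (-1)) (Real.exp_pos _).le).trans ?_
  rw [← Real.exp_add, Real.exp_le_exp]
  have hmean : (Real.exp (-1) - 1) * ρ.real B ≤ -(q / 2) := by
    nlinarith [Real.exp_neg_one_lt_d9, measureReal_nonneg (μ := ρ) (s := B)]
  nlinarith [Nat.cast_nonneg (α := ℝ) (Fintype.card ι)]

end Chernoff

section RandomGraph

open unitInterval

theorem measurePreserving_adj_binomialRandom {V κ : Type*} [Countable V] [Fintype κ] (p : I)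
    (i : V) {f : κ → V} (hf : Function.Injective f) (hfi : ∀ k, f k ≠ i) :
    MeasurePreserving (fun (G : SimpleGraph V) k => G.Adj i (f k))
      (SimpleGraph.binomialRandom V p) (Measure.pi fun _ => bernoulliMeasure True False p) := by
  refine ⟨by fun_prop, ?_⟩
  have hinj : Function.Injective fun k => s(i, f k) := fun k l hkl => hf (Sym2.congr_right.1 hkl)
  have hset : Measurable fun S : Sym2 V → Prop => {e | S e} :=
    MeasurableEquiv.setOfPred.measurable
  rw [SimpleGraph.binomialRandom_eq_map, setBernoulli_eq_map,
    Measure.map_map SimpleGraph.measurable_fromEdgeSet hset,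
    Measure.map_map (by fun_prop) (SimpleGraph.measurable_fromEdgeSet.comp hset)]
  have hcomp : (fun (G : SimpleGraph V) k => G.Adj i (f k)) ∘ SimpleGraph.fromEdgeSet ∘
      (fun S : Sym2 V → Prop => {e | S e}) = fun S k => S s(i, f k) := by
    ext S k
    simp [(hfi k).symm]
  rw [hcomp, Measure.map_infinitePi_infinitePi_of_inj hinj, Measure.infinitePi_eq_pi]
  simp [bernoulliMeasure_def, (hfi _).symm]

theorem measureReal_prod_le_of_forall {X Y : Type*} [MeasurableSpace X] [MeasurableSpace Y]
    (μ : Measure X) [IsProbabilityMeasure μ] (ν : Measure Y) [IsFiniteMeasure ν] {T : Set (X × Y)}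
    (hT : MeasurableSet T) {ε : ℝ} (hε : ∀ x, ν.real (Prod.mk x ⁻¹' T) ≤ ε) :
    (μ.prod ν).real T ≤ ε := by
  obtain ⟨x₀⟩ := μ.nonempty_of_neZero
  refine ENNReal.toReal_le_of_le_ofReal (measureReal_nonneg.trans (hε x₀)) ?_
  rw [Measure.prod_apply hT]
  calc ∫⁻ x, ν (Prod.mk x ⁻¹' T) ∂μ ≤ ∫⁻ _, ENNReal.ofReal ε ∂μ := by
        refine lintegral_mono fun x => ?_
        rw [← ofReal_measureReal]
        exact ENNReal.ofReal_le_ofReal (hε x)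
    _ = ENNReal.ofReal ε := by simp

theorem measureReal_prod_bernoulli {X : Type*} [MeasurableSpace X] (μ : Measure X) (p : I)
    (B : Set X) : (μ.prod (bernoulliMeasure True False p)).real (B ×ˢ {b | b}) = p * μ.real B := by
  simp [measureReal_prod_prod, mul_comm]

open scoped Classical in
/-- The number of neighbours `j` of `i` in `G` such that `(t i, t j)` lies in `A`. -/
noncomputable def nbrCount {V X : Type*} [Fintype V] (A : Set (X × X)) (t : V → X)
    (G : SimpleGraph V) (i : V) : ℕ :=
  (Finset.univ.filter fun j => G.Adj i j ∧ (t i, t j) ∈ A).card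

theorem nbrCount_le_nbrCount {V X : Type*} [Fintype V] {A B : Set (X × X)} {t : V → X}
    {G : SimpleGraph V} {i : V} (h : ∀ j, (t i, t j) ∈ A → (t i, t j) ∈ B) :
    nbrCount A t G i ≤ nbrCount B t G i := by
  classical
  exact Finset.card_le_card (Finset.monotone_filter_right _ fun j _ hj => ⟨hj.1, h j hj.2⟩)

theorem nbrCount_eq_hitCount {X : Type*} {m : ℕ} (A : Set (X × X)) (t : Fin (m + 1) → X)
    (G : SimpleGraph (Fin (m + 1))) (i : Fin (m + 1)) :
    nbrCount A t G i = hitCount ((Prod.mk (t i) ⁻¹' A) ×ˢ {b | b})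
      fun k => (t (i.succAbove k), G.Adj i (i.succAbove k)) := by
  classical
  simp only [nbrCount, hitCount, Finset.card_filter, Fin.sum_univ_succAbove _ i]
  simp [and_comm]

variable {X : Type*} [MeasurableSpace X] (μ : Measure X) [IsProbabilityMeasure μ]

theorem measurePreserving_star {m : ℕ} (p : I) (i : Fin (m + 1)) :
    MeasurePreserving (fun z : (Fin (m + 1) → X) × SimpleGraph (Fin (m + 1)) =>
        (z.1 i, fun k => (z.1 (i.succAbove k), z.2.Adj i (i.succAbove k))))
      ((Measure.pi fun _ => μ).prod (SimpleGraph.binomialRandom (Fin (m + 1)) p))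
      (μ.prod (Measure.pi fun _ => μ.prod (bernoulliMeasure True False p))) := by
  have hadj := measurePreserving_adj_binomialRandom p i Fin.succAbove_right_injective
    (Fin.succAbove_ne i)
  have hsplit := (measurePreserving_piFinSuccAbove (fun _ => μ) i).prod hadj
  have hzip := (MeasurePreserving.id μ).prod
    (measurePreserving_arrowProdEquivProdArrow X Prop (Fin m) (fun _ => μ)
      (fun _ => bernoulliMeasure True False p)).symm
  exact hzip.comp ((measurePreserving_prodAssoc _ _ _).comp hsplit)

theorem measurable_hitCount_section {m : ℕ} {A : Set (X × X)} (hA : MeasurableSet A) :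
    Measurable fun z : X × (Fin m → X × Prop) =>
      hitCount ((Prod.mk z.1 ⁻¹' A) ×ˢ {b | b}) z.2 := by
  have hA' : MeasurableSet (A ×ˢ {b : Prop | b}) :=
    hA.prod (measurableSet_setOfPred.2 measurable_id)
  have hpair : Measurable fun (z : X × (Fin m → X × Prop)) k =>
    ((z.1, (z.2 k).1), (z.2 k).2) := by fun_prop
  exact (measurable_hitCount hA').comp hpair

variable {μ}

/-- Conditionally on the location of `i`, the pairs of a location and an adjacency to `i`, over all
other vertices, are independent, so the count is a sum of independent indicators. -/
theorem measureReal_nbrCount_mem_le {m : ℕ} (p : I) (i : Fin (m + 1)) {A : Set (X × X)}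
    (hA : MeasurableSet A) {S : Set ℕ} {ε : ℝ}
    (hε : ∀ x, (Measure.pi fun _ : Fin m => μ.prod (bernoulliMeasure True False p)).real
      {w | hitCount ((Prod.mk x ⁻¹' A) ×ˢ {b | b}) w ∈ S} ≤ ε) :
    ((Measure.pi fun _ => μ).prod (SimpleGraph.binomialRandom (Fin (m + 1)) p)).real
      {z | nbrCount A z.1 z.2 i ∈ S} ≤ ε := by
  set T : Set (X × (Fin m → X × Prop)) :=
    {z | hitCount ((Prod.mk z.1 ⁻¹' A) ×ˢ {b | b}) z.2 ∈ S}
  have hT : MeasurableSet T := measurable_hitCount_section hA (MeasurableSet.of_discrete (s := S))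
  simp only [nbrCount_eq_hitCount]
  have hstar := (measurePreserving_star μ p i).measureReal_preimage hT.nullMeasurableSet
  exact hstar.trans_le (measureReal_prod_le_of_forall μ _ hT hε)

theorem measureReal_nbrCount_ge_le {m : ℕ} (p : I) (i : Fin (m + 1)) {A : Set (X × X)}
    (hA : MeasurableSet A) {q : ℝ} (hq : ∀ x, μ.real (Prod.mk x ⁻¹' A) ≤ q) (k : ℝ) :
    ((Measure.pi fun _ => μ).prod (SimpleGraph.binomialRandom (Fin (m + 1)) p)).real
      {z | k ≤ nbrCount A z.1 z.2 i} ≤ Real.exp (2 * (p * q) * m - k) := by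
  refine measureReal_nbrCount_mem_le p i hA (S := {a | k ≤ a}) fun x => ?_
  simpa using measureReal_hitCount_ge_le (ι := Fin m) (μ.prod (bernoulliMeasure True False p))
    ((measurable_prodMk_left hA).prod (measurableSet_setOfPred.2 measurable_id))
    ((measureReal_prod_bernoulli μ p _).trans_le (mul_le_mul_of_nonneg_left (hq x) p.2.1)) k

theorem measureReal_nbrCount_le_le {m : ℕ} (p : I) (i : Fin (m + 1)) {A : Set (X × X)}
    (hA : MeasurableSet A) {q : ℝ} (hq : ∀ x, q ≤ μ.real (Prod.mk x ⁻¹' A)) (k : ℝ) :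
    ((Measure.pi fun _ => μ).prod (SimpleGraph.binomialRandom (Fin (m + 1)) p)).real
      {z | (nbrCount A z.1 z.2 i : ℝ) ≤ k} ≤ Real.exp (k - p * q * m / 2) := by
  refine measureReal_nbrCount_mem_le p i hA (S := {a | (a : ℝ) ≤ k}) fun x => ?_
  simpa using measureReal_hitCount_le_le (ι := Fin m) (μ.prod (bernoulliMeasure True False p))
    ((measurable_prodMk_left hA).prod (measurableSet_setOfPred.2 measurable_id))
    ((mul_le_mul_of_nonneg_left (hq x) p.2.1).trans_eq (measureReal_prod_bernoulli μ p _).symm) k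

end RandomGraph

section Gaussian

theorem gaussianReal_real_Icc_eq (a b : ℝ) :
    (gaussianReal 0 1).real (Set.Icc a b) = ∫ x in Set.Icc a b, gaussianPDFReal 0 1 x := by
  rw [measureReal_def, gaussianReal_apply_eq_integral _ one_ne_zero, ENNReal.toReal_ofReal]
  exact setIntegral_nonneg measurableSet_Icc fun x _ => gaussianPDFReal_nonneg 0 1 x

theorem gaussianPDFReal_le_half (x : ℝ) : gaussianPDFReal 0 1 x ≤ 1 / 2 := by
  have hsqrt : (2 : ℝ) ≤ √(2 * Real.pi) :=
    Real.le_sqrt_of_sq_le (by nlinarith [Real.two_le_pi])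
  have hexp : Real.exp (-x ^ 2 / 2) ≤ 1 := Real.exp_le_one_iff.2 (by nlinarith [sq_nonneg x])
  calc gaussianPDFReal 0 1 x = (√(2 * Real.pi))⁻¹ * Real.exp (-x ^ 2 / 2) := by
        simp [gaussianPDFReal]
    _ ≤ 2⁻¹ * 1 := by gcongr
    _ = 1 / 2 := by norm_num

theorem gaussianReal_real_Icc_le {a b : ℝ} (hab : a ≤ b) :
    (gaussianReal 0 1).real (Set.Icc a b) ≤ (b - a) / 2 := by
  rw [gaussianReal_real_Icc_eq]
  calc ∫ x in Set.Icc a b, gaussianPDFReal 0 1 x ≤ ∫ _ in Set.Icc a b, (1 / 2 : ℝ) :=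
        setIntegral_mono (integrable_gaussianPDFReal 0 1).integrableOn
          (integrableOn_const isCompact_Icc.measure_ne_top) gaussianPDFReal_le_half
    _ = (b - a) / 2 := by simp [hab, div_eq_mul_inv]

theorem le_gaussianReal_real_Icc {a b R : ℝ} (hab : a ≤ b) (ha : -R ≤ a) (hb : b ≤ R) :
    (b - a) * gaussianPDFReal 0 1 R ≤ (gaussianReal 0 1).real (Set.Icc a b) := by
  rw [gaussianReal_real_Icc_eq]
  calc (b - a) * gaussianPDFReal 0 1 R = ∫ _ in Set.Icc a b, gaussianPDFReal 0 1 R := by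
        simp [hab]
    _ ≤ ∫ x in Set.Icc a b, gaussianPDFReal 0 1 x := by
        refine setIntegral_mono_on (integrableOn_const isCompact_Icc.measure_ne_top)
          (integrable_gaussianPDFReal 0 1).integrableOn measurableSet_Icc fun x hx => ?_
        have hx2 : x ^ 2 ≤ R ^ 2 := sq_le_sq' (ha.trans hx.1) (hx.2.trans hb)
        simp only [gaussianPDFReal, sub_zero]
        gcongr

variable {ι : Type*} [Fintype ι]

theorem stdGaussian_real_forall_mem {s : ι → Set ℝ} (hs : ∀ k, MeasurableSet (s k)) :
    (stdGaussian (EuclideanSpace ℝ ι)).real {y | ∀ k, y k ∈ s k} =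
      ∏ k, (gaussianReal 0 1).real (s k) := by
  have hbox : MeasurableSet {y : EuclideanSpace ℝ ι | ∀ k, y k ∈ s k} := by
    rw [Set.ofPred_forall]
    exact MeasurableSet.iInter fun k =>
      (by fun_prop : Measurable fun y : EuclideanSpace ℝ ι => y k) (hs k)
  rw [← map_pi_eq_stdGaussian, map_measureReal_apply (by fun_prop) hbox]
  have hpre : WithLp.toLp 2 ⁻¹' {y : EuclideanSpace ℝ ι | ∀ k, y k ∈ s k} = Set.univ.pi s := by
    ext y
    simp
  rw [hpre, measureReal_def, Measure.pi_pi, ENNReal.toReal_prod]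
  rfl

theorem stdGaussian_real_norm_sub_le_le (x : EuclideanSpace ℝ ι) {r : ℝ} (hr : 0 ≤ r) :
    (stdGaussian (EuclideanSpace ℝ ι)).real {y | ‖x - y‖ ≤ r} ≤ r ^ Fintype.card ι := by
  have hsub : {y | ‖x - y‖ ≤ r} ⊆ {y | ∀ k, y k ∈ Set.Icc (x k - r) (x k + r)} := by
    intro y hy k
    have := abs_le.1 ((PiLp.norm_apply_le (x - y) k).trans hy)
    simp only [PiLp.sub_apply] at this
    constructor <;> linarith
  refine (measureReal_mono hsub).trans ?_
  rw [stdGaussian_real_forall_mem fun _ => measurableSet_Icc]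
  calc ∏ k, (gaussianReal 0 1).real (Set.Icc (x k - r) (x k + r)) ≤ ∏ _ : ι, r :=
        Finset.prod_le_prod (fun _ _ => measureReal_nonneg) fun k _ =>
          (gaussianReal_real_Icc_le (by linarith)).trans_eq (by ring)
    _ = r ^ Fintype.card ι := by simp

theorem box_subset_annulus [Nonempty ι] (x : EuclideanSpace ℝ ι) {r s : ℝ} (hr : 0 ≤ r)
    (hs : 0 ≤ s) (hrs : Fintype.card ι * s ^ 2 = r ^ 2) :
    {y : EuclideanSpace ℝ ι | ∀ k, y k ∈ Set.Icc (x k + s / 2) (x k + s)} ⊆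
      {y | r / 2 ≤ ‖x - y‖ ∧ ‖x - y‖ ≤ r} := by
  intro y hy
  have hcoord (k : ι) : s / 2 ≤ ‖(x - y) k‖ ∧ ‖(x - y) k‖ ≤ s := by
    have hk := hy k
    rw [PiLp.sub_apply, norm_sub_rev, Real.norm_of_nonneg (by linarith [hk.1])]
    constructor <;> linarith [hk.1, hk.2]
  have hnorm : ‖x - y‖ ^ 2 = ∑ k, ‖(x - y) k‖ ^ 2 := EuclideanSpace.norm_sq_eq _
  constructor
  · refine le_of_sq_le_sq ?_ (norm_nonneg _)
    calc (r / 2) ^ 2 = ∑ _ : ι, (s / 2) ^ 2 := by simp; linarith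
      _ ≤ ‖x - y‖ ^ 2 := by rw [hnorm]; gcongr with k; exact (hcoord k).1
  · refine le_of_sq_le_sq ?_ hr
    calc ‖x - y‖ ^ 2 ≤ ∑ _ : ι, s ^ 2 := by rw [hnorm]; gcongr with k; exact (hcoord k).2
      _ = r ^ 2 := by simp [hrs]

theorem exists_le_stdGaussian_real_annulus [Nonempty ι] (R : ℝ) :
    ∃ δ : ℝ, 0 < δ ∧ ∀ (x : EuclideanSpace ℝ ι) (r : ℝ), ‖x‖ ≤ R → 0 ≤ r → r ≤ R →
      δ * r ^ Fintype.card ι ≤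
        (stdGaussian (EuclideanSpace ℝ ι)).real {y | r / 2 ≤ ‖x - y‖ ∧ ‖x - y‖ ≤ r} := by
  set d : ℝ := (Fintype.card ι : ℝ)
  have hd : 1 ≤ d := Nat.one_le_cast.2 (Fintype.card_pos (α := ι))
  have hκ : 0 < gaussianPDFReal 0 1 (2 * R) := gaussianPDFReal_pos 0 1 _ one_ne_zero
  refine ⟨(1 / (2 * √d) * gaussianPDFReal 0 1 (2 * R)) ^ Fintype.card ι, by positivity,
    fun x r hx hr hrR => ?_⟩
  set s : ℝ := r / √d with hs
  have hs0 : 0 ≤ s := by positivity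
  have hsr : s ≤ r := div_le_self hr (Real.one_le_sqrt.2 hd)
  have hrs : d * s ^ 2 = r ^ 2 := by
    rw [hs, div_pow, Real.sq_sqrt (by positivity)]
    field_simp
  refine le_trans ?_ (measureReal_mono (box_subset_annulus x hr hs0 hrs))
  rw [stdGaussian_real_forall_mem fun _ => measurableSet_Icc, ← mul_pow]
  calc (1 / (2 * √d) * gaussianPDFReal 0 1 (2 * R) * r) ^ Fintype.card ι
      = ∏ _ : ι, (s / 2 * gaussianPDFReal 0 1 (2 * R)) := by
        rw [Finset.prod_const, Finset.card_univ, hs]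
        ring
    _ ≤ ∏ k, (gaussianReal 0 1).real (Set.Icc (x k + s / 2) (x k + s)) := by
        refine Finset.prod_le_prod (fun _ _ => by positivity) fun k _ => ?_
        have hxk := abs_le.1 ((PiLp.norm_apply_le x k).trans hx)
        refine le_trans (le_of_eq (by ring)) (le_gaussianReal_real_Icc ?_ ?_ ?_) <;> linarith

theorem exists_measureReal_sqrt_log_lt_norm_le {E : Type*} [NormedAddCommGroup E] [NormedSpace ℝ E]
    [CompleteSpace E] [SecondCountableTopology E] [MeasurableSpace E] [BorelSpace E]
    (μ : Measure E) [IsGaussian μ] (k : ℕ) :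
    ∃ M D : ℝ, 0 < M ∧ 0 < D ∧ ∀ n : ℕ, 1 ≤ n →
      μ.real {x | M * √(Real.log n) < ‖x‖} ≤ D / (n : ℝ) ^ k := by
  obtain ⟨c, hc, hint⟩ := IsGaussian.exists_integrable_exp_sq μ
  refine ⟨√((k + 1) / c), ∫ x, Real.exp (c * ‖x‖ ^ 2) ∂μ, by positivity, integral_exp_pos hint,
    fun n hn => ?_⟩
  have hn0 : (0 : ℝ) < n := by exact_mod_cast hn
  have : 0 ≤ Real.log n := Real.log_natCast_nonneg n
  have hsub : {x : E | √((k + 1) / c) * √(Real.log n) < ‖x‖} ⊆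
      {x | (n : ℝ) ^ k ≤ Real.exp (c * ‖x‖ ^ 2)} := by
    intro x hx
    have hsq : (k + 1) / c * Real.log n ≤ ‖x‖ ^ 2 := by
      rw [← Real.sqrt_le_left (norm_nonneg x), Real.sqrt_mul (by positivity)]
      exact hx.le
    have hexp : k * Real.log n ≤ c * ‖x‖ ^ 2 := by
      calc k * Real.log n ≤ (k + 1) * Real.log n := by gcongr; simp
        _ = c * ((k + 1) / c * Real.log n) := by field_simp
        _ ≤ c * ‖x‖ ^ 2 := by gcongr
    calc (n : ℝ) ^ k = Real.exp (k * Real.log n) := by rw [Real.exp_nat_mul, Real.exp_log hn0]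
      _ ≤ Real.exp (c * ‖x‖ ^ 2) := Real.exp_le_exp.2 hexp
  have hmarkov := mul_meas_ge_le_integral_of_nonneg
    (ae_of_all μ fun x => (Real.exp_pos (c * ‖x‖ ^ 2)).le) hint ((n : ℝ) ^ k)
  rw [le_div_iff₀ (by positivity), mul_comm]
  refine le_trans ?_ hmarkov
  exact mul_le_mul_of_nonneg_left (measureReal_mono hsub) (by positivity)

end Gaussian

section EdgeLoss

theorem norm_starProjection_orthogonal_span_singleton_le {F : Type*} [NormedAddCommGroup F]
    [InnerProductSpace ℝ F] (g v : F) (a : ℝ) :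
    ‖(Submodule.span ℝ {g})ᗮ.starProjection v‖ ≤ ‖v - a • g‖ := by
  have hg : (Submodule.span ℝ {g})ᗮ.starProjection (a • g) = 0 := by
    rw [Submodule.starProjection_apply_eq_zero_iff, Submodule.orthogonal_orthogonal]
    exact Submodule.smul_mem _ _ (Submodule.mem_span_singleton_self g)
  calc ‖(Submodule.span ℝ {g})ᗮ.starProjection v‖
      = ‖(Submodule.span ℝ {g})ᗮ.starProjection (v - a • g)‖ := by rw [map_sub, hg, sub_zero]
    _ ≤ ‖v - a • g‖ := Submodule.norm_starProjection_apply_le _ _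

/-- The ray of the displacements `a • g`, `1 ≤ a`, on which the loss of an edge with assigned
direction `g` vanishes. -/
def losslessRay (g : E3) : Set E3 := (fun a : ℝ => a • g) '' Set.Ici 1

theorem edgeLoss_eq_infDist {g : E3} (hg : ‖g‖ = 1) (x y : E3) :
    edgeLoss g x y = Metric.infDist (x - y) (losslessRay g) := by
  refine le_antisymm ((Metric.le_infDist (Set.nonempty_Ici.image _)).2 ?_) ?_
  · rintro _ ⟨a, ha, rfl⟩
    rw [dist_eq_norm, edgeLoss]
    split_ifs with h
    · exact norm_starProjection_orthogonal_span_singleton_le g (x - y) a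
    · rw [← sq_le_sq₀ (norm_nonneg _) (norm_nonneg _), norm_sub_sq_real, norm_sub_sq_real (x - y),
        norm_smul, inner_smul_right, hg, real_inner_comm, Real.norm_eq_abs, mul_one, sq_abs]
      nlinarith [not_lt.1 h, Set.mem_Ici.1 ha]
  · rw [edgeLoss]
    split_ifs with h
    · rw [Submodule.starProjection_orthogonal_val, Submodule.starProjection_unit_singleton ℝ hg,
        ← dist_eq_norm]
      exact Metric.infDist_le_dist_of_mem ⟨_, h.le, rfl⟩
    · rw [← dist_eq_norm]
      exact Metric.infDist_le_dist_of_mem ⟨1, Set.self_mem_Ici, one_smul ℝ g⟩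

theorem edgeLoss_le_edgeLoss_add {g : E3} (hg : ‖g‖ = 1) (x y x' y' : E3) :
    edgeLoss g x y ≤ edgeLoss g x' y' + ‖(x - y) - (x' - y')‖ := by
  rw [edgeLoss_eq_infDist hg, edgeLoss_eq_infDist hg, ← dist_eq_norm]
  exact Metric.infDist_le_infDist_add_dist

theorem edgeLoss_add_const (g x y s : E3) : edgeLoss g (x + s) (y + s) = edgeLoss g x y := by
  simp only [edgeLoss, add_sub_add_right_eq_sub]

theorem edgeLoss_smul_eq_max {g : E3} (hg : ‖g‖ = 1) {x y : E3} {a : ℝ} (h : x - y = a • g) :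
    edgeLoss g x y = max 0 (1 - a) := by
  rw [edgeLoss, h, inner_smul_right, real_inner_self_eq_norm_sq, hg, one_pow, mul_one]
  split_ifs with ha
  · rw [max_eq_left (by linarith), norm_eq_zero, Submodule.starProjection_apply_eq_zero_iff,
      Submodule.orthogonal_orthogonal]
    exact Submodule.smul_mem _ _ (Submodule.mem_span_singleton_self g)
  · calc ‖a • g - g‖ = ‖(a - 1) • g‖ := by rw [sub_smul, one_smul]
      _ = |a - 1| := by rw [norm_smul, hg, mul_one, Real.norm_eq_abs]
      _ = max 0 (1 - a) := by
        rw [abs_of_nonpos (by linarith), max_eq_right (by linarith), neg_sub]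

theorem norm_direction {x y : E3} (h : x ≠ y) : ‖direction x y‖ = 1 := by
  rw [direction, norm_smul, norm_inv, norm_norm]
  exact inv_mul_cancel₀ (norm_ne_zero_iff.2 (sub_ne_zero.2 h))

theorem norm_smul_direction (x y : E3) : ‖x - y‖ • direction x y = x - y := by
  rcases eq_or_ne x y with rfl | h
  · simp
  · exact smul_inv_smul₀ (norm_ne_zero_iff.2 (sub_ne_zero.2 h)) _

theorem edgeLoss_direction_smul {x y : E3} (h : x ≠ y) (c : ℝ) :
    edgeLoss (direction x y) (c • x) (c • y) = max 0 (1 - c * ‖x - y‖) :=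
  edgeLoss_smul_eq_max (norm_direction h) (by rw [mul_smul, norm_smul_direction, smul_sub])

theorem le_edgeLoss_direction_sub {x y : E3} {r : ℝ} (hr : 0 < r) (c : ℝ) :
    (1 / r - c) * (if ‖x - y‖ ≤ r then ‖x - y‖ else 0) ≤
      edgeLoss (direction x y) (c • x) (c • y) -
        edgeLoss (direction x y) ((1 / r) • x) ((1 / r) • y) := by
  rcases eq_or_ne x y with rfl | h
  · simp [edgeLoss]
  rw [edgeLoss_direction_smul h, edgeLoss_direction_smul h, one_div_mul_eq_div]
  split_ifs with hshort
  · rw [max_eq_right (sub_nonneg.2 ((div_le_one hr).2 hshort)), sub_mul, one_div_mul_eq_div]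
    linarith [le_max_right 0 (1 - c * ‖x - y‖)]
  · rw [max_eq_left (sub_nonpos.2 ((one_le_div hr).2 (not_le.1 hshort).le))]
    simp

theorem neg_le_edgeLoss_sub {g : E3} (hg : ‖g‖ = 1) (x y : E3) {c c' : ℝ} (hc : c ≤ c') :
    -((c' - c) * ‖x - y‖) ≤ edgeLoss g (c • x) (c • y) - edgeLoss g (c' • x) (c' • y) := by
  have hmove := edgeLoss_le_edgeLoss_add hg (c' • x) (c' • y) (c • x) (c • y)
  have hdiff : c' • x - c' • y - (c • x - c • y) = (c' - c) • (x - y) := by module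
  rw [hdiff, norm_smul, Real.norm_of_nonneg (sub_nonneg.2 hc)] at hmove
  linarith

end EdgeLoss

section TotalLength

theorem sum_sum_eq_two_mul_sum_lt {V : Type*} [Fintype V] [LinearOrder V] {f : V → V → ℝ}
    (hsymm : ∀ i j, f i j = f j i) (hdiag : ∀ i, f i i = 0) :
    ∑ i, ∑ j, f i j = 2 * ∑ i, ∑ j, if i < j then f i j else 0 := by
  have hsplit (i j : V) : f i j = (if i < j then f i j else 0) + if j < i then f j i else 0 := by
    rcases lt_trichotomy i j with h | rfl | h
    · simp [h, h.not_gt]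
    · simp [hdiag]
    · simp [h, h.not_gt, hsymm i j]
  calc ∑ i, ∑ j, f i j
      = ∑ i, ∑ j, (if i < j then f i j else 0) + ∑ i, ∑ j, (if j < i then f j i else 0) := by
        simp only [← Finset.sum_add_distrib, ← hsplit]
    _ = 2 * ∑ i, ∑ j, if i < j then f i j else 0 := by
        rw [Finset.sum_comm (f := fun i j => if j < i then f j i else 0), two_mul]

variable {V F : Type*} [SeminormedAddCommGroup F] {t : V → F}

/-- The edges of `E` of length at most `r` in the configuration `t`. -/
def shortEdges (t : V → F) (E : SimpleGraph V) (r : ℝ) : SimpleGraph V where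
  Adj i j := E.Adj i j ∧ ‖t i - t j‖ ≤ r
  symm := ⟨fun i j h => ⟨h.1.symm, by rw [norm_sub_rev]; exact h.2⟩⟩
  loopless := ⟨fun i h => E.loopless.irrefl i h.1⟩

/-- The pairs of points whose distance lies between `a` and `b`. -/
def distPairs (a b : ℝ) : Set (F × F) := {z | a ≤ ‖z.1 - z.2‖ ∧ ‖z.1 - z.2‖ ≤ b}

variable [Fintype V]

open scoped Classical in
/-- The total length of the edges of `G` in the configuration `t`, each edge being counted twice,
once for either orientation. -/
noncomputable def totalLength (t : V → F) (G : SimpleGraph V) : ℝ :=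
  ∑ i, ∑ j, if G.Adj i j then ‖t i - t j‖ else 0

open scoped Classical in
theorem totalLength_eq_two_mul_sum_lt [LinearOrder V] (t : V → F) (G : SimpleGraph V) :
    totalLength t G = 2 * ∑ i, ∑ j, if i < j then if G.Adj i j then ‖t i - t j‖ else 0 else 0 :=
  sum_sum_eq_two_mul_sum_lt (fun i j => by rw [G.adj_comm, norm_sub_rev]) fun i => by simp

theorem totalLength_le (G : SimpleGraph V) [DecidableRel G.Adj] {R : ℝ} (ht : ∀ i, ‖t i‖ ≤ R) :
    totalLength t G ≤ Fintype.card V * (G.maxDegree * (2 * R)) := by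
  have hrow (i : V) : ∑ j, (if G.Adj i j then ‖t i - t j‖ else 0) ≤ G.maxDegree * (2 * R) := by
    have hR : 0 ≤ R := (norm_nonneg (t i)).trans (ht i)
    calc ∑ j, (if G.Adj i j then ‖t i - t j‖ else 0)
        ≤ ∑ j, if G.Adj i j then 2 * R else 0 := by
          gcongr with j
          split_ifs
          · linarith [norm_sub_le (t i) (t j), ht i, ht j]
          · rfl
      _ = G.degree i * (2 * R) := by
          rw [← Finset.sum_filter, Finset.sum_const, nsmul_eq_mul, ← G.neighborFinset_eq_filter,
            G.card_neighborFinset_eq_degree]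
      _ ≤ G.maxDegree * (2 * R) := by
          gcongr
          exact G.degree_le_maxDegree i
  calc totalLength t G = ∑ i, ∑ j, if G.Adj i j then ‖t i - t j‖ else 0 := by
        unfold totalLength
        congr! 5
    _ ≤ ∑ _ : V, G.maxDegree * (2 * R) := Finset.sum_le_sum fun i _ => hrow i
    _ = Fintype.card V * (G.maxDegree * (2 * R)) := by simp

theorem le_totalLength_shortEdges {E : SimpleGraph V} {B : Set F} {a r N k : ℝ} (ha : 0 ≤ a)
    (hk : 0 ≤ k) (hN : N ≤ hitCount B t)
    (hcount : ∀ i, t i ∈ B → k ≤ nbrCount (distPairs a r) t E i) :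
    N * (k * a) ≤ totalLength t (shortEdges t E r) := by
  classical
  have hrow (i : V) : (if t i ∈ B then k * a else 0) ≤
      ∑ j, if (shortEdges t E r).Adj i j then ‖t i - t j‖ else 0 := by
    split_ifs with hi
    · calc k * a ≤ nbrCount (distPairs a r) t E i * a := by
            gcongr
            exact hcount i hi
        _ = ∑ j, if E.Adj i j ∧ (t i, t j) ∈ distPairs a r then a else 0 := by
            simp [nbrCount, ← Finset.sum_filter]
        _ ≤ ∑ j, if (shortEdges t E r).Adj i j then ‖t i - t j‖ else 0 := by
            gcongr with j
            split_ifs with hann hshort hshort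
            · exact hann.2.1
            · exact absurd ⟨hann.1, hann.2.2⟩ hshort
            · positivity
            · rfl
    · positivity
  calc N * (k * a) ≤ hitCount B t * (k * a) := by gcongr
    _ = ∑ i, if t i ∈ B then k * a else 0 := by simp [hitCount, ← Finset.sum_filter]
    _ ≤ totalLength t (shortEdges t E r) := Finset.sum_le_sum fun i _ => hrow i

theorem degree_shortEdges (t : V → F) (E : SimpleGraph V) (r : ℝ)
    [DecidableRel (shortEdges t E r).Adj] (i : V) :
    (shortEdges t E r).degree i = nbrCount (distPairs 0 r) t E i := by
  rw [← SimpleGraph.card_neighborFinset_eq_degree, SimpleGraph.neighborFinset_eq_filter]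
  refine congrArg Finset.card (Finset.ext fun j => ?_)
  simp only [Finset.mem_filter_univ]
  simp [shortEdges, distPairs]

end TotalLength

section Oracle

variable {n : ℕ} {t : Fin n → E3} {E Eb : SimpleGraph (Fin n)} {γ : Fin n → Fin n → E3}

theorem objective_add_const (E : SimpleGraph (Fin n)) (γ : Fin n → Fin n → E3) (x : Fin n → E3)
    (s : E3) : objective E γ (fun i => x i + s) = objective E γ x := by
  simp only [objective, edgeLoss_add_const]

theorem IsOracleSolution.objective_le (hn : n ≠ 0) {c : ℝ} {s : E3}
    (h : IsOracleSolution t E γ c s) (c' : ℝ) :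
    objective E γ (fun i => c • t i) ≤ objective E γ (fun i => c' • t i) := by
  set s' : E3 := -((n : ℝ)⁻¹ • ∑ i, c' • t i)
  have hcentred : ∑ i, (c' • t i + s') = 0 := by
    have : (n : ℝ) ≠ 0 := Nat.cast_ne_zero.2 hn
    simp [s', Finset.sum_add_distrib, ← Nat.cast_smul_eq_nsmul ℝ, smul_inv_smul₀ this]
  simpa only [objective_add_const] using h.2 c' s' hcentred

open scoped Classical in
theorem IsCorruptedData.le_edgeLoss_sub (hdata : IsCorruptedData t E Eb γ) {c r : ℝ} (hr : 0 < r)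
    (hc : c ≤ 1 / r) {i j : Fin n} (hij : i < j) (hE : E.Adj i j) :
    (1 / r - c) * ((if (shortEdges t E r).Adj i j then ‖t i - t j‖ else 0) -
        2 * if Eb.Adj i j then ‖t i - t j‖ else 0) ≤
      edgeLoss (γ i j) (c • t i) (c • t j) -
        edgeLoss (γ i j) ((1 / r) • t i) ((1 / r) • t j) := by
  by_cases hEb : Eb.Adj i j
  · refine le_trans ?_ (neg_le_edgeLoss_sub (hdata.bad i j hij hEb) (t i) (t j) hc)
    rw [← mul_neg, if_pos hEb]
    refine mul_le_mul_of_nonneg_left ?_ (sub_nonneg.2 hc)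
    split_ifs <;> linarith [norm_nonneg (t i - t j)]
  · rw [hdata.good i j hij ⟨hE, hEb⟩]
    simpa [hEb, hE, shortEdges] using le_edgeLoss_direction_sub (x := t i) (y := t j) hr c

theorem IsCorruptedData.le_objective_sub (hdata : IsCorruptedData t E Eb γ) {c r : ℝ}
    (hr : 0 < r) (hc : c ≤ 1 / r) :
    (1 / r - c) * (totalLength t (shortEdges t E r) - 2 * totalLength t Eb) ≤
      2 * (objective E γ (fun i => c • t i) - objective E γ (fun i => (1 / r) • t i)) := by
  classical
  simp only [objective, totalLength_eq_two_mul_sum_lt, mul_sub, Finset.mul_sum,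
    ← Finset.sum_sub_distrib]
  refine Finset.sum_le_sum fun i _ => Finset.sum_le_sum fun j _ => ?_
  by_cases hij : i < j
  · by_cases hE : E.Adj i j
    · have hedge := hdata.le_edgeLoss_sub hr hc hij hE
      simp only [hij, hE, true_and, if_true]
      linarith
    · have hEb : ¬ Eb.Adj i j := fun h => hE (hdata.bad_le h)
      simp [hE, hEb, shortEdges]
  · simp [hij]

theorem IsOracleSolution.totalLength_shortEdges_le (hdata : IsCorruptedData t E Eb γ) {c r : ℝ}
    {s : E3} (horacle : IsOracleSolution t E γ c s) (hr : 0 < r) (hc : c < 1 / r) :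
    totalLength t (shortEdges t E r) ≤ 2 * totalLength t Eb := by
  rcases eq_or_ne n 0 with rfl | hn
  · simp [totalLength]
  have hgain := (hdata.le_objective_sub hr hc.le).trans
    (mul_nonpos_of_nonneg_of_nonpos zero_le_two
      (sub_nonpos.2 (horacle.objective_le hn (1 / r))))
  exact sub_nonpos.1 (nonpos_of_mul_nonpos_right hgain (sub_pos.2 hc))

theorem sdiff_goodLong_le {c r : ℝ} (hr : 0 < r) (hc : 1 / r ≤ c) :
    E \ goodLong t E Eb c ≤ Eb ⊔ shortEdges t E r := by
  intro i j hij
  have hc0 : 0 < c := (one_div_pos.2 hr).trans_le hc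
  by_cases hEb : Eb.Adj i j
  · exact Or.inl hEb
  · refine Or.inr ⟨hij.1, ?_⟩
    by_contra! hlong
    exact hij.2 ⟨⟨hij.1, hEb⟩, hc0, ((one_div_le hr hc0).1 hc).trans_lt hlong⟩

end Oracle

section NormMaxDegree

variable {n : ℕ}

theorem normMaxDegree_eq (G : SimpleGraph (Fin n)) [DecidableRel G.Adj] :
    normMaxDegree G = G.maxDegree / n := by
  unfold normMaxDegree
  congr!

theorem degree_le_mul_normMaxDegree (G : SimpleGraph (Fin n)) [DecidableRel G.Adj] (i : Fin n) :
    (G.degree i : ℝ) ≤ n * normMaxDegree G := by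
  have hn : (n : ℝ) ≠ 0 := Nat.cast_ne_zero.2 i.pos.ne'
  rw [normMaxDegree_eq, mul_div_cancel₀ _ hn]
  exact_mod_cast G.degree_le_maxDegree i

theorem normMaxDegree_le (hn : n ≠ 0) {G : SimpleGraph (Fin n)} [DecidableRel G.Adj] {d : ℝ}
    (h : ∀ i, (G.degree i : ℝ) ≤ n * d) : normMaxDegree G ≤ d := by
  have : NeZero n := ⟨hn⟩
  obtain ⟨i, hi⟩ := G.exists_maximal_degree_vertex
  rw [normMaxDegree_eq, hi, div_le_iff₀' (by positivity)]
  exact h i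

theorem normMaxDegree_le_add {G H₁ H₂ : SimpleGraph (Fin n)} (h : G ≤ H₁ ⊔ H₂) :
    normMaxDegree G ≤ normMaxDegree H₁ + normMaxDegree H₂ := by
  classical
  rcases eq_or_ne n 0 with rfl | hn
  · simp [normMaxDegree]
  refine normMaxDegree_le hn fun i => ?_
  have hdeg : G.degree i ≤ H₁.degree i + H₂.degree i := by
    simp only [← SimpleGraph.card_neighborFinset_eq_degree]
    refine (Finset.card_le_card fun j hj => ?_).trans (Finset.card_union_le _ _)
    simpa using h ((G.mem_neighborFinset i j).1 hj)
  calc (G.degree i : ℝ) ≤ H₁.degree i + H₂.degree i := by exact_mod_cast hdeg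
    _ ≤ n * normMaxDegree H₁ + n * normMaxDegree H₂ :=
      add_le_add (degree_le_mul_normMaxDegree H₁ i) (degree_le_mul_normMaxDegree H₂ i)
    _ = n * (normMaxDegree H₁ + normMaxDegree H₂) := by ring

theorem epsZero_le_add_normMaxDegree_shortEdges {t : Fin n → E3} {E Eb : SimpleGraph (Fin n)}
    {c r : ℝ} (hr : 0 < r) (hc : 1 / r ≤ c) :
    epsZero t E Eb c ≤ normMaxDegree Eb + normMaxDegree (shortEdges t E r) :=
  normMaxDegree_le_add (sdiff_goodLong_le hr hc)

theorem totalLength_le_of_normMaxDegree_le {t : Fin n → E3} {G : SimpleGraph (Fin n)} {d R : ℝ}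
    (hd : normMaxDegree G ≤ d) (ht : ∀ i, ‖t i‖ ≤ R) :
    totalLength t G ≤ n * (n * d * (2 * R)) := by
  classical
  rcases eq_or_ne n 0 with rfl | hn
  · simp [totalLength]
  have : NeZero n := ⟨hn⟩
  have hR : 0 ≤ R := (norm_nonneg (t 0)).trans (ht 0)
  have hmax : (G.maxDegree : ℝ) ≤ n * d := by
    rwa [normMaxDegree_eq, div_le_iff₀' (by positivity)] at hd
  calc totalLength t G ≤ n * (G.maxDegree * (2 * R)) := by simpa using totalLength_le G ht
    _ ≤ n * (n * d * (2 * R)) := by gcongr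

end NormMaxDegree

section Regular

variable {n : ℕ}

/-- Regularity, at scale `r`, of the graph `E` on the locations `t`: the locations have norm at most
`R`, every vertex has at most `3 d n` neighbours at distance at most `r`, a proportion of at least
`δ / 4` of the vertices lies in the unit ball, and each of these has at least `δ d n / 8` neighbours
at distance between `r / 2` and `r`. -/
structure IsRegular (δ R d r : ℝ) (t : Fin n → E3) (E : SimpleGraph (Fin n)) : Prop where
  norm_le : ∀ i, ‖t i‖ ≤ R
  short_le : ∀ i, (nbrCount (distPairs 0 r) t E i : ℝ) ≤ 3 * d * n
  le_central : δ * n / 4 ≤ hitCount {x : E3 | ‖x‖ ≤ 1} t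
  le_annulus : ∀ i, ‖t i‖ ≤ 1 → δ * d * n / 8 ≤ nbrCount (distPairs (r / 2) r) t E i

variable {t : Fin n → E3} {E Eb : SimpleGraph (Fin n)} {γ : Fin n → Fin n → E3} {δ R d r : ℝ}

theorem IsRegular.normMaxDegree_shortEdges_le (hn : n ≠ 0) (h : IsRegular δ R d r t E) :
    normMaxDegree (shortEdges t E r) ≤ 3 * d := by
  classical
  refine normMaxDegree_le hn fun i => ?_
  rw [degree_shortEdges, mul_comm]
  exact h.short_le i

theorem IsRegular.one_div_le (hn : n ≠ 0) (h : IsRegular δ R d r t E) (hδ : 0 ≤ δ) (hd : 0 ≤ d)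
    (hr : 0 < r) (hdata : IsCorruptedData t E Eb γ) {εb : ℝ} (hEb : normMaxDegree Eb ≤ εb)
    (hεb : 256 * R * εb < δ ^ 2 * d * r) {c : ℝ} {s : E3} (horacle : IsOracleSolution t E γ c s) :
    1 / r ≤ c := by
  by_contra! hc
  have hlower : δ * n / 4 * (δ * d * n / 8 * (r / 2)) ≤ totalLength t (shortEdges t E r) :=
    le_totalLength_shortEdges (by positivity) (by positivity) h.le_central h.le_annulus
  have hupper := totalLength_le_of_normMaxDegree_le hEb h.norm_le
  have hshort := horacle.totalLength_shortEdges_le hdata hr hc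
  have hn0 : (0 : ℝ) < n ^ 2 := by positivity
  nlinarith [mul_lt_mul_of_pos_left hεb hn0]

theorem IsRegular.epsZero_le (hn : n ≠ 0) (h : IsRegular δ R d r t E) (hδ : 0 ≤ δ) (hd : 0 ≤ d)
    (hr : 0 < r) (hdata : IsCorruptedData t E Eb γ) {εb : ℝ} (hEb : normMaxDegree Eb ≤ εb)
    (hεb : 256 * R * εb < δ ^ 2 * d * r) {c : ℝ} {s : E3} (horacle : IsOracleSolution t E γ c s) :
    epsZero t E Eb c ≤ εb + 3 * d :=
  (epsZero_le_add_normMaxDegree_shortEdges hr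
    (h.one_div_le hn hδ hd hr hdata hEb hεb horacle)).trans
      (add_le_add hEb (h.normMaxDegree_shortEdges_le hn))

end Regular

section Probability

open unitInterval

/-- The joint law of the locations and of the graph in the model with parameters `n` and `p`. -/
noncomputable abbrev modelLaw (n : ℕ) (p : I) : Measure ((Fin n → E3) × SimpleGraph (Fin n)) :=
  (Measure.pi fun _ => stdGaussian E3).prod (SimpleGraph.binomialRandom (Fin n) p)

theorem measurableSet_distPairs (a b : ℝ) : MeasurableSet (distPairs a b : Set (E3 × E3)) :=
  (measurableSet_le (g := fun z : E3 × E3 => ‖z.1 - z.2‖) measurable_const (by fun_prop)).inter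
    (measurableSet_le (f := fun z : E3 × E3 => ‖z.1 - z.2‖) (by fun_prop) measurable_const)

variable {n : ℕ}

theorem modelLaw_real_location_mem (p : I) (i : Fin n) {B : Set E3} (hB : MeasurableSet B) :
    (modelLaw n p).real {z | z.1 i ∈ B} = (stdGaussian E3).real B :=
  ((measurePreserving_eval (fun _ => stdGaussian E3) i).comp
    measurePreserving_fst).measureReal_preimage hB.nullMeasurableSet

theorem modelLaw_real_hitCount_le (p : I) {B : Set E3} (hB : MeasurableSet B) {q : ℝ}
    (hq : q ≤ (stdGaussian E3).real B) :
    (modelLaw n p).real {z | (hitCount B z.1 : ℝ) ≤ q * n / 4} ≤ Real.exp (-(q * n / 4)) := by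
  have hmeas : MeasurableSet {w : Fin n → E3 | (hitCount B w : ℝ) ≤ q * n / 4} :=
    measurableSet_le (measurable_from_top.comp (measurable_hitCount hB)) measurable_const
  refine (measurePreserving_fst.measureReal_preimage hmeas.nullMeasurableSet).trans_le ?_
  refine (measureReal_hitCount_le_le (ι := Fin n) (stdGaussian E3) hB hq _).trans ?_
  rw [Fintype.card_fin, Real.exp_le_exp]
  linarith

theorem modelLaw_real_short_ge_le (p : I) (i : Fin n) {r : ℝ} (hr : 0 ≤ r) :
    (modelLaw n p).real
        {z | 3 * (p * r ^ 3) * n ≤ nbrCount (distPairs 0 r) z.1 z.2 i} ≤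
      Real.exp (-(p * r ^ 3 * n)) := by
  obtain _ | m := n
  · exact i.elim0
  refine (measureReal_nbrCount_ge_le p i (measurableSet_distPairs 0 r) (q := r ^ 3)
    (fun x => by simpa [distPairs] using stdGaussian_real_norm_sub_le_le x hr) _).trans ?_
  have hd : 0 ≤ p * r ^ 3 := mul_nonneg p.2.1 (by positivity)
  rw [Real.exp_le_exp]
  push_cast
  linarith

theorem modelLaw_real_annulus_le_le (hn : 2 ≤ n) (p : I) (i : Fin n) {r q : ℝ} (hq0 : 0 ≤ q)
    (hq : ∀ x : E3, ‖x‖ ≤ 1 → q ≤ (stdGaussian E3).real (Prod.mk x ⁻¹' distPairs (r / 2) r)) :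
    (modelLaw n p).real {z | ‖z.1 i‖ ≤ 1 ∧
        (nbrCount (distPairs (r / 2) r) z.1 z.2 i : ℝ) ≤ p * q * n / 8} ≤
      Real.exp (-(p * q * n / 8)) := by
  obtain _ | m := n
  · exact i.elim0
  -- Counting all neighbours of the vertices outside the unit ball makes the bound uniform in `x`.
  set A : Set (E3 × E3) := {z | ‖z.1‖ ≤ 1 → z ∈ distPairs (r / 2) r}
  have hA : MeasurableSet A := (measurableSet_le (by fun_prop) measurable_const).imp
    (measurableSet_distPairs (r / 2) r)
  have hqA (x : E3) : q ≤ (stdGaussian E3).real (Prod.mk x ⁻¹' A) := by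
    by_cases hx : ‖x‖ ≤ 1
    · exact (hq x hx).trans (measureReal_mono fun y hy _ => hy)
    · simpa [A, hx] using (hq 0 (by simp)).trans measureReal_le_one
  refine le_trans (measureReal_mono ?_)
    ((measureReal_nbrCount_le_le p i hA hqA (p * q * (m + 1 : ℕ) / 8)).trans ?_)
  · rintro z ⟨hz, hcount⟩
    exact (Nat.cast_le.2 (nbrCount_le_nbrCount (A := A) fun j hj => hj hz)).trans hcount
  · have hm : (1 : ℝ) ≤ m := by exact_mod_cast Nat.le_of_succ_le_succ hn
    rw [Real.exp_le_exp]
    push_cast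
    nlinarith [mul_nonneg p.2.1 hq0]

theorem exp_neg_le_one_div_pow {n k : ℕ} (hn : n ≠ 0) {x : ℝ} (hx : k * Real.log n ≤ x) :
    Real.exp (-x) ≤ 1 / (n : ℝ) ^ k := by
  calc Real.exp (-x) ≤ Real.exp (-(k * Real.log n)) := Real.exp_le_exp.2 (neg_le_neg hx)
    _ = 1 / (n : ℝ) ^ k := by
      rw [Real.exp_neg, Real.exp_nat_mul, Real.exp_log (by positivity), one_div]

theorem modelLaw_real_not_isRegular_le (p : I) {δ R d r a b : ℝ}
    (hcentral : (modelLaw n p).real {z | hitCount {x : E3 | ‖x‖ ≤ 1} z.1 ≤ δ * n / 4} ≤ a)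
    (hnorm : ∀ i, (modelLaw n p).real {z | R < ‖z.1 i‖} ≤ b)
    (hshort : ∀ i, (modelLaw n p).real
      {z | 3 * d * n ≤ nbrCount (distPairs 0 r) z.1 z.2 i} ≤ a)
    (hannulus : ∀ i, (modelLaw n p).real
      {z | ‖z.1 i‖ ≤ 1 ∧ nbrCount (distPairs (r / 2) r) z.1 z.2 i ≤ δ * d * n / 8} ≤ a) :
    (modelLaw n p).real {z | ¬ IsRegular δ R d r z.1 z.2} ≤ a + n * (b + (a + a)) := by
  set A : Set ((Fin n → E3) × SimpleGraph (Fin n)) :=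
    {z | hitCount {x : E3 | ‖x‖ ≤ 1} z.1 ≤ δ * n / 4}
  set B : Fin n → Set ((Fin n → E3) × SimpleGraph (Fin n)) := fun i => {z | R < ‖z.1 i‖}
  set S : Fin n → Set ((Fin n → E3) × SimpleGraph (Fin n)) := fun i =>
    {z | 3 * d * n ≤ nbrCount (distPairs 0 r) z.1 z.2 i}
  set T : Fin n → Set ((Fin n → E3) × SimpleGraph (Fin n)) := fun i =>
    {z | ‖z.1 i‖ ≤ 1 ∧ nbrCount (distPairs (r / 2) r) z.1 z.2 i ≤ δ * d * n / 8}
  have hsub : {z | ¬ IsRegular δ R d r z.1 z.2} ⊆ A ∪ ⋃ i, (B i ∪ (S i ∪ T i)) := by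
    intro z hz
    by_contra! hgood
    simp only [A, B, S, T, Set.mem_union, Set.mem_iUnion, Set.mem_ofPred_eq, not_or, not_exists,
      not_and, not_le, not_lt] at hgood
    exact hz ⟨fun i => (hgood.2 i).1, fun i => (hgood.2 i).2.1.le, hgood.1.le,
      fun i hi => ((hgood.2 i).2.2 hi).le⟩
  have hunion (i : Fin n) : (modelLaw n p).real (B i ∪ (S i ∪ T i)) ≤ b + (a + a) :=
    (measureReal_union_le _ _).trans (add_le_add (hnorm i)
      ((measureReal_union_le _ _).trans (add_le_add (hshort i) (hannulus i))))
  calc (modelLaw n p).real {z | ¬ IsRegular δ R d r z.1 z.2}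
      ≤ (modelLaw n p).real A + (modelLaw n p).real (⋃ i, (B i ∪ (S i ∪ T i))) :=
        (measureReal_mono hsub).trans (measureReal_union_le _ _)
    _ ≤ a + ∑ _ : Fin n, (b + (a + a)) :=
        add_le_add hcentral ((measureReal_iUnion_fintype_le _).trans
          (Finset.sum_le_sum fun i _ => hunion i))
    _ = a + n * (b + (a + a)) := by
        rw [Finset.sum_const, Finset.card_univ, Fintype.card_fin, nsmul_eq_mul]

theorem exists_le_stdGaussian_real_unitBall_annulus :
    ∃ δ : ℝ, 0 < δ ∧ δ ≤ (stdGaussian E3).real {x | ‖x‖ ≤ 1} ∧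
      ∀ (x : E3) (r : ℝ), ‖x‖ ≤ 1 → 0 ≤ r → r ≤ 1 →
        δ * r ^ 3 ≤ (stdGaussian E3).real (Prod.mk x ⁻¹' distPairs (r / 2) r) := by
  obtain ⟨δ, hδ, hannulus⟩ := exists_le_stdGaussian_real_annulus (ι := Fin 3) 1
  refine ⟨δ, hδ, ?_, fun x r hx hr hr1 => by simpa [distPairs] using hannulus x r hx hr hr1⟩
  have hsub : {y : E3 | 1 / 2 ≤ ‖0 - y‖ ∧ ‖0 - y‖ ≤ 1} ⊆ {x | ‖x‖ ≤ 1} := fun y hy => by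
    simpa using hy.2
  simpa using (hannulus 0 1 (by simp) zero_le_one le_rfl).trans (measureReal_mono hsub)

theorem one_div_pow_succ_add_mul_le {n : ℕ} (hn : n ≠ 0) (k : ℕ) (D : ℝ) :
    1 / (n : ℝ) ^ (k + 1) +
        n * (D / (n : ℝ) ^ (k + 1) + (1 / (n : ℝ) ^ (k + 1) + 1 / (n : ℝ) ^ (k + 1))) ≤
      (D + 3) / (n : ℝ) ^ k := by
  have hinv : 1 / (n : ℝ) ≤ 1 := by simpa using Nat.cast_inv_le_one n
  calc 1 / (n : ℝ) ^ (k + 1) +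
        n * (D / (n : ℝ) ^ (k + 1) + (1 / (n : ℝ) ^ (k + 1) + 1 / (n : ℝ) ^ (k + 1)))
      = (1 / n + (D + 2)) / (n : ℝ) ^ k := by
        field_simp
        ring
    _ ≤ (D + 3) / (n : ℝ) ^ k := div_le_div_of_nonneg_right (by linarith) (by positivity)

theorem exists_modelLaw_real_not_isRegular_le (k : ℕ) :
    ∃ δ M D : ℝ, 0 < δ ∧ 0 < M ∧ 0 < D ∧ ∀ (n : ℕ) (p : I) (r : ℝ), 2 ≤ n → 0 < r → r ≤ 1 →
      8 * (k + 1) * Real.log n ≤ δ * (p * r ^ 3) * n →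
      (modelLaw n p).real {z | ¬ IsRegular δ (M * √(Real.log n)) (p * r ^ 3) r z.1 z.2} ≤
        D / (n : ℝ) ^ k := by
  obtain ⟨δ, hδ, hball, hannulus⟩ := exists_le_stdGaussian_real_unitBall_annulus
  obtain ⟨M, D, hM, hD, htail⟩ := exists_measureReal_sqrt_log_lt_norm_le (stdGaussian E3) (k + 1)
  have hδ1 : δ ≤ 1 := hball.trans measureReal_le_one
  refine ⟨δ, M, D + 3, hδ, hM, by positivity, fun n p r hn hr hr1 hlog => ?_⟩
  have hn0 : n ≠ 0 := by omega
  have hd : 0 ≤ p * r ^ 3 := mul_nonneg p.2.1 (by positivity)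
  have hd1 : p * r ^ 3 ≤ 1 := mul_le_one₀ p.2.2 (by positivity) (pow_le_one₀ hr.le hr1)
  have hδd : δ * (p * r ^ 3) * n ≤ p * r ^ 3 * n :=
    mul_le_mul_of_nonneg_right (mul_le_of_le_one_left hd hδ1) n.cast_nonneg
  have hδn : δ * (p * r ^ 3) * n ≤ δ * n :=
    mul_le_mul_of_nonneg_right (mul_le_of_le_one_right hδ.le hd1) n.cast_nonneg
  have hrate : ((k + 1 : ℕ) : ℝ) * Real.log n ≤ δ * (p * r ^ 3) * n / 8 := by
    push_cast
    linarith
  have hrate0 : 0 ≤ δ * (p * r ^ 3) * n := by positivity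
  refine (modelLaw_real_not_isRegular_le p (a := 1 / (n : ℝ) ^ (k + 1))
    (b := D / (n : ℝ) ^ (k + 1)) ?_ (fun i => ?_) (fun i => ?_) fun i => ?_).trans ?_
  · exact (modelLaw_real_hitCount_le p (measurableSet_le (by fun_prop) measurable_const)
      hball).trans (exp_neg_le_one_div_pow hn0 (by linarith))
  · exact (modelLaw_real_location_mem p i
      (measurableSet_lt measurable_const (by fun_prop))).trans_le (htail n (by omega))
  · exact (modelLaw_real_short_ge_le p i hr.le).trans
      (exp_neg_le_one_div_pow hn0 (by linarith))
  · have hq : p * (δ * r ^ 3) * n / 8 = δ * (p * r ^ 3) * n / 8 := by ring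
    have hbound := modelLaw_real_annulus_le_le hn p i (r := r) (q := δ * r ^ 3) (by positivity)
      fun x hx => hannulus x r hx hr.le hr1
    rw [hq] at hbound
    exact hbound.trans (exp_neg_le_one_div_pow hn0 hrate)
  · exact one_div_pow_succ_add_mul_le hn0 k D

end Probability

section Scale

variable {n : ℕ} {Ω : Type*} [MeasurableSpace Ω] {P : Measure Ω}
  {p : unitInterval} {εb : ℝ} {t : Ω → Fin n → E3} {E Eb : Ω → SimpleGraph (Fin n)}
  {γ : Ω → Fin n → Fin n → E3}

theorem IsHLVModel.measure_not_epsZero_le (hmodel : IsHLVModel p εb P t E Eb γ) (hn : n ≠ 0)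
    {δ R d r : ℝ} (hδ : 0 ≤ δ) (hd : 0 ≤ d) (hr : 0 < r) (hεb : 256 * R * εb < δ ^ 2 * d * r) :
    P {ω | ¬ ∀ (c : ℝ) (s : E3), IsOracleSolution (t ω) (E ω) (γ ω) c s →
        epsZero (t ω) (E ω) (Eb ω) c ≤ εb + 3 * d} ≤
      modelLaw n p {z | ¬ IsRegular δ R d r z.1 z.2} := by
  rw [modelLaw, ← hmodel.law.map_eq]
  refine le_trans (measure_mono_ae ?_) (Measure.le_map_apply hmodel.law.aemeasurable _)
  filter_upwards [hmodel.data, hmodel.level] with ω hdata hlevel hfail hregular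
  exact hfail fun c s => hregular.epsZero_le hn hδ hd hr hdata hlevel hεb

end Scale

theorem exists_measure_not_epsZero_le (k : ℕ) :
    ∃ δ M D : ℝ, 0 < δ ∧ 0 < M ∧ 0 < D ∧
      ∀ (n : ℕ) (p : unitInterval) (εb r : ℝ), 2 ≤ n → 0 < r → r ≤ 1 →
        8 * (k + 1) * Real.log n ≤ δ * (p * r ^ 3) * n →
        M * √(Real.log n) * εb < δ * (p * r ^ 4) →
        ∀ (Ω : Type*) [MeasurableSpace Ω] (P : Measure Ω)
          (t : Ω → Fin n → E3) (E Eb : Ω → SimpleGraph (Fin n)) (γ : Ω → Fin n → Fin n → E3),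
          IsHLVModel p εb P t E Eb γ →
          P {ω | ¬ ∀ (c : ℝ) (s : E3), IsOracleSolution (t ω) (E ω) (γ ω) c s →
              epsZero (t ω) (E ω) (Eb ω) c ≤ εb + 3 * (p * r ^ 3)} ≤
            ENNReal.ofReal (D / (n : ℝ) ^ k) := by
  obtain ⟨δ, M, D, hδ, hM, hD, hregular⟩ := exists_modelLaw_real_not_isRegular_le k
  refine ⟨δ, 256 * M / δ, D, hδ, by positivity, hD, ?_⟩
  intro n p εb r hn hr hr1 hlog hεb Ω _ P t E Eb γ hmodel
  have hd : 0 ≤ p * r ^ 3 := mul_nonneg p.2.1 (by positivity)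
  have hbad : 256 * (M * √(Real.log n)) * εb < δ ^ 2 * (p * r ^ 3) * r := by
    calc 256 * (M * √(Real.log n)) * εb = δ * (256 * M / δ * √(Real.log n) * εb) := by
          field_simp
      _ < δ * (δ * (p * r ^ 4)) := mul_lt_mul_of_pos_left hεb hδ
      _ = δ ^ 2 * (p * r ^ 3) * r := by ring
  refine (hmodel.measure_not_epsZero_le (by omega) hδ.le hd hr hbad).trans ?_
  rw [← ofReal_measureReal]
  exact ENNReal.ofReal_le_ofReal (hregular n p r hn hr hr1 hlog)

section ScaleChoice

/-- The length below which edges count as short: the power of `p` makes the total length of the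
short edges comparable to that of the bad edges at the critical corruption level, and the factor
`1 / L`, for `L = log n`, compensates for the tails of the Gaussian locations. -/
noncomputable def shortScale (a p L : ℝ) : ℝ := a * p ^ (1 / 3 : ℝ) / L

variable {p L : ℝ}

theorem mul_shortScale_pow_three (hp : 0 ≤ p) (a : ℝ) :
    p * shortScale a p L ^ 3 = a ^ 3 * (p ^ 2 / L ^ 3) := by
  have hroot : (p ^ (1 / 3 : ℝ)) ^ 3 = p := by
    rw [← Real.rpow_natCast, ← Real.rpow_mul hp]
    norm_num
  rw [shortScale, div_pow, mul_pow, hroot]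
  ring

theorem mul_shortScale_pow_four (hp : 0 < p) (a : ℝ) :
    p * shortScale a p L ^ 4 = a ^ 4 * (p ^ (7 / 3 : ℝ) / L ^ 4) := by
  have hroot : p * (p ^ (1 / 3 : ℝ)) ^ 4 = p ^ (7 / 3 : ℝ) := by
    rw [← Real.rpow_natCast, ← Real.rpow_mul hp.le, ← Real.rpow_one_add' hp.le (by norm_num)]
    norm_num
  rw [shortScale, div_pow, mul_pow, ← hroot]
  ring

theorem sqrt_mul_div_rpow (hL : 0 < L) (b : ℝ) : √L * (b / L ^ (9 / 2 : ℝ)) = b / L ^ 4 := by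
  have hsplit : L ^ (9 / 2 : ℝ) = √L * L ^ 4 := by
    rw [Real.sqrt_eq_rpow, ← Real.rpow_natCast, ← Real.rpow_add hL]
    norm_num
  have hsqrt : √L ≠ 0 := (Real.sqrt_pos.2 hL).ne'
  rw [hsplit]
  field_simp

theorem rpow_div_rpow_le (hp : 0 < p) (hp1 : p ≤ 1) (hL : 1 ≤ L) :
    p ^ (7 / 3 : ℝ) / L ^ (9 / 2 : ℝ) ≤ p ^ 2 / L ^ 3 := by
  have hnum : p ^ (7 / 3 : ℝ) ≤ p ^ 2 := by
    rw [← Real.rpow_natCast]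
    exact Real.rpow_le_rpow_of_exponent_ge hp hp1 (by norm_num)
  have hden : L ^ 3 ≤ L ^ (9 / 2 : ℝ) := by
    rw [← Real.rpow_natCast]
    exact Real.rpow_le_rpow_of_exponent_le hL (by norm_num)
  gcongr

theorem shortScale_pos {a : ℝ} (ha : 0 < a) (hp : 0 < p) (hL : 0 < L) : 0 < shortScale a p L := by
  rw [shortScale]
  positivity

theorem shortScale_le_one {a : ℝ} (ha : 0 ≤ a) (hp : 0 ≤ p) (hp1 : p ≤ 1) (hL : 0 < L)
    (haL : a ≤ L) : shortScale a p L ≤ 1 := by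
  rw [shortScale, div_le_one hL]
  exact (mul_le_of_le_one_right ha (Real.rpow_le_one hp hp1 (by norm_num))).trans haL

theorem le_mul_shortScale_pow_three_mul {a b C δ x : ℝ} (ha : 0 ≤ a) (hC : 0 ≤ C) (hδ : 0 ≤ δ)
    (hL : 0 < L) (hx : 0 < x) (hp : C * (L ^ 2 / √x) ≤ p) (hb : b ≤ δ * a ^ 3 * C ^ 2) :
    b * L ≤ δ * (p * shortScale a p L ^ 3) * x := by
  have hp0 : 0 ≤ p := le_trans (by positivity) hp
  have hsq : C ^ 2 * L ^ 4 ≤ p ^ 2 * x := by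
    calc C ^ 2 * L ^ 4 = (C * (L ^ 2 / √x)) ^ 2 * x := by
          rw [mul_pow, div_pow, Real.sq_sqrt hx.le]
          field_simp
      _ ≤ p ^ 2 * x := by gcongr
  calc b * L ≤ δ * a ^ 3 * C ^ 2 * L := by gcongr
    _ = δ * a ^ 3 * (C ^ 2 * L ^ 4) / L ^ 3 := by field_simp
    _ ≤ δ * a ^ 3 * (p ^ 2 * x) / L ^ 3 := by gcongr
    _ = δ * (p * shortScale a p L ^ 3) * x := by
        rw [mul_shortScale_pow_three hp0]
        ring

theorem mul_sqrt_mul_lt_mul_shortScale_pow_four {a C M δ ε : ℝ} (hM : 0 ≤ M) (hp : 0 < p)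
    (hL : 0 < L) (hε : ε ≤ C * p ^ (7 / 3 : ℝ) / L ^ (9 / 2 : ℝ)) (hMC : M * C < δ * a ^ 4) :
    M * √L * ε < δ * (p * shortScale a p L ^ 4) := by
  calc M * √L * ε ≤ M * √L * (C * p ^ (7 / 3 : ℝ) / L ^ (9 / 2 : ℝ)) := by gcongr
    _ = M * C * (p ^ (7 / 3 : ℝ) / L ^ 4) := by
        rw [mul_assoc, sqrt_mul_div_rpow hL]
        ring
    _ < δ * a ^ 4 * (p ^ (7 / 3 : ℝ) / L ^ 4) := by gcongr
    _ = δ * (p * shortScale a p L ^ 4) := by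
        rw [mul_shortScale_pow_four hp]
        ring

theorem add_mul_shortScale_pow_three_le {C ε : ℝ} (hp : 0 < p) (hp1 : p ≤ 1) (hL : 1 ≤ L)
    (hC : 0 ≤ C) (hε : ε ≤ C * p ^ (7 / 3 : ℝ) / L ^ (9 / 2 : ℝ)) (a : ℝ) :
    ε + 3 * (p * shortScale a p L ^ 3) ≤ (C + 3 * a ^ 3) * p ^ 2 / L ^ 3 := by
  calc ε + 3 * (p * shortScale a p L ^ 3)
      ≤ C * (p ^ (7 / 3 : ℝ) / L ^ (9 / 2 : ℝ)) + 3 * (a ^ 3 * (p ^ 2 / L ^ 3)) := by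
        rw [mul_shortScale_pow_three hp.le]
        gcongr
        rwa [← mul_div_assoc]
    _ ≤ C * (p ^ 2 / L ^ 3) + 3 * (a ^ 3 * (p ^ 2 / L ^ 3)) := by
        gcongr C * ?_ + _
        exact rpow_div_rpow_le hp hp1 hL
    _ = (C + 3 * a ^ 3) * p ^ 2 / L ^ 3 := by ring

theorem exists_pos_le_mul_pow_three_lt_mul_pow_four {δ C : ℝ} (hδ : 0 < δ) (hC : 0 < C)
    (x y : ℝ) : ∃ a : ℝ, 0 < a ∧ x ≤ δ * a ^ 3 * C ∧ y < δ * a ^ 4 := by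
  have h3 : Tendsto (fun a : ℝ => δ * a ^ 3 * C) atTop atTop :=
    ((tendsto_pow_atTop three_ne_zero).const_mul_atTop hδ).atTop_mul_const hC
  have h4 : Tendsto (fun a : ℝ => δ * a ^ 4) atTop atTop :=
    (tendsto_pow_atTop four_ne_zero).const_mul_atTop hδ
  exact ((eventually_gt_atTop 0).and
    ((h3.eventually_ge_atTop x).and (h4.eventually_gt_atTop y))).exists

theorem eventually_le_log_natCast (a : ℝ) : ∀ᶠ n : ℕ in atTop, a ≤ Real.log n :=
  (Real.tendsto_log_atTop.comp tendsto_natCast_atTop_atTop).eventually_ge_atTop a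

theorem eventually_log_sq_div_sqrt_le :
    ∀ᶠ n : ℕ in atTop, Real.log n ^ 2 / √n ≤ (Real.log n / n) ^ (1 / 3 : ℝ) := by
  have hlittle := ((isLittleO_log_rpow_rpow_atTop (5 / 3)
    (by norm_num : (0 : ℝ) < 1 / 6)).comp_tendsto tendsto_natCast_atTop_atTop).def zero_lt_one
  filter_upwards [hlittle, eventually_le_log_natCast 1, eventually_gt_atTop 0] with n hn hlog hpos
  have hn0 : (0 : ℝ) < n := by exact_mod_cast hpos
  have hlog0 : 0 < Real.log n := by linarith
  simp only [Function.comp_apply, one_mul, Real.norm_eq_abs] at hn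
  rw [abs_of_nonneg (by positivity), abs_of_nonneg (by positivity)] at hn
  have hsq : Real.log n ^ 2 = Real.log n ^ (1 / 3 : ℝ) * Real.log n ^ (5 / 3 : ℝ) := by
    rw [← Real.rpow_natCast, ← Real.rpow_add hlog0]
    norm_num
  have hsqrt : √n = (n : ℝ) ^ (1 / 3 : ℝ) * (n : ℝ) ^ (1 / 6 : ℝ) := by
    rw [Real.sqrt_eq_rpow, ← Real.rpow_add hn0]
    norm_num
  rw [Real.div_rpow hlog0.le hn0.le, hsq, hsqrt, mul_div_mul_comm]
  exact mul_le_of_le_one_right (by positivity) ((div_le_one (by positivity)).2 hn)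

end ScaleChoice

end HLV

open MeasureTheory Filter in
theorem theorem4_general (k : ℕ) (C₀ C₁ : ℝ) (hC₀ : 0 < C₀) (hC₁ : 0 < C₁) :
    ∃ K C : ℝ, 0 < K ∧ 0 < C ∧
      ∀ᶠ n : ℕ in atTop, ∀ (p : unitInterval) (εb : ℝ),
        C₀ * (Real.log n ^ 2 / √n) ≤ (p : ℝ) →
        εb ≤ C₁ * (p : ℝ) ^ (7 / 3 : ℝ) / Real.log n ^ (9 / 2 : ℝ) →
        ∀ (Ω : Type*) [MeasurableSpace Ω] (P : Measure Ω)
          (t : Ω → Fin n → HLV.E3) (E Eb : Ω → SimpleGraph (Fin n))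
          (γ : Ω → Fin n → Fin n → HLV.E3),
          HLV.IsHLVModel p εb P t E Eb γ →
          P {ω | ¬ ∀ (c : ℝ) (s : HLV.E3),
                HLV.IsOracleSolution (t ω) (E ω) (γ ω) c s →
                HLV.epsZero (t ω) (E ω) (Eb ω) c ≤ K * (p : ℝ) ^ 2 / Real.log n ^ 3}
            ≤ ENNReal.ofReal (C / (n : ℝ) ^ k) := by
  obtain ⟨δ, M, D, hδ, hM, hD, hscale⟩ := HLV.exists_measure_not_epsZero_le k
  obtain ⟨a, ha0, hlarge, hbad⟩ :=
    HLV.exists_pos_le_mul_pow_three_lt_mul_pow_four hδ (pow_pos hC₀ 2) (8 * (k + 1)) (M * C₁)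
  refine ⟨C₁ + 3 * a ^ 3, D, by positivity, hD, ?_⟩
  filter_upwards [eventually_ge_atTop 2, HLV.eventually_le_log_natCast 1,
    HLV.eventually_le_log_natCast a] with n hn hL1 hLa p εb hp hεb Ω _ P t E Eb γ hmodel
  have hL0 : 0 < Real.log n := by linarith
  have hp0 : 0 < (p : ℝ) := lt_of_lt_of_le (by positivity) hp
  refine le_trans (measure_mono fun ω hfail => ?_)
    (hscale n p εb (HLV.shortScale a p (Real.log n)) hn (HLV.shortScale_pos ha0 hp0 hL0)
      (HLV.shortScale_le_one ha0.le p.2.1 p.2.2 hL0 hLa)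
      (HLV.le_mul_shortScale_pow_three_mul ha0.le hC₀.le hδ.le hL0 (by positivity) hp hlarge)
      (HLV.mul_sqrt_mul_lt_mul_shortScale_pow_four hM.le hp0 hL0 hεb hbad) Ω P t E Eb γ hmodel)
  exact fun h => hfail fun c s hcs =>
    (h c s hcs).trans (HLV.add_mul_shortScale_pow_three_le hp0 p.2.2 hL1 hC₁.le hεb a)

theorem theorem4 (C₀ C₁ : ℝ) (hC₀ : 0 < C₀) (hC₁ : 0 < C₁) :
    ∃ (K C : ℝ) (n₀ : ℕ), 0 < K ∧ 0 < C ∧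
      ∀ (n : ℕ), n₀ ≤ n → ∀ (p : unitInterval) (εb : ℝ),
        C₀ * (Real.log n / n) ^ (1 / 3 : ℝ) ≤ (p : ℝ) →
        εb ≤ C₁ * (p : ℝ) ^ (7 / 3 : ℝ) / Real.log n ^ (9 / 2 : ℝ) →
        ∀ (Ω : Type*) [MeasurableSpace Ω] (P : MeasureTheory.Measure Ω)
          [MeasureTheory.IsProbabilityMeasure P]
          (t : Ω → Fin n → HLV.E3) (E Eb : Ω → SimpleGraph (Fin n))
          (γ : Ω → Fin n → Fin n → HLV.E3),
          HLV.IsHLVModel p εb P t E Eb γ →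
          P {ω | ¬ ∀ (c : ℝ) (s : HLV.E3),
                HLV.IsOracleSolution (t ω) (E ω) (γ ω) c s →
                HLV.epsZero (t ω) (E ω) (Eb ω) c ≤ K * (p : ℝ) ^ 2 / Real.log n ^ 3}
            ≤ ENNReal.ofReal (C / (n : ℝ) ^ 5) := by
  obtain ⟨K, C, hK, hC, hgeneral⟩ := theorem4_general 5 C₀ C₁ hC₀ hC₁
  obtain ⟨n₀, hn₀⟩ :=
    Filter.eventually_atTop.1 (hgeneral.and HLV.eventually_log_sq_div_sqrt_le)
  exact ⟨K, C, n₀, hK, hC, fun n hn p εb hp hεb Ω _ P _ => (hn₀ n hn).1 p εb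
    ((mul_le_mul_of_nonneg_left (hn₀ n hn).2 hC₀.le).trans hp) hεb Ω P⟩
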